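/- Let $A$ be an associative algebra over a commutative ring $R$ and let $M$ be an $R$-submodule of $A$. For $\vartheta\in\{\text{left},\text{right},\text{pre-two-sided},\text{two-sided}\}$, call $M$ a $\vartheta$-Mathieu subspace of $A$ if for all $a,b,c\in A$ such that $a^m\in M$ for all $m\ge 1$, the following holds for all sufficiently large $m$: \begin{itemize} \item $ba^m\in M$, if $\vartheta=$ left; \item $a^mc\in M$, if $\vartheta=$ right; \item $ba^m\in M$ and $a^mc\in M$, if $\vartheta=$ pre-two-sided; \item $ba^mc\in M$, if $\vartheta=$ two-sided. \end{itemize} Theorem. Let $K$ be a field and $n$ a natural number such that $\operatorname{char} K\notin\{1,2,\ldots,n-1\}$, and let $M$ be a proper $K$-subspace of $\operatorname{Mat}_n(K)$ of codimension less than $n$. Then for each of the four types $\vartheta$, $M$ is a $\vartheta$-Mathieu subspace of $\operatorname{Mat}_n(K)$ if and only if $\operatorname{tr} A=0$ for all $A\in M$ and, in addition, $\operatorname{char} K\ne n$ or $I_n\notin M$ (or both). -/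

import Mathlib

/-- The four types of Mathieu subspaces. -/
inductive MathieuType where
  | left
  | right
  | preTwoSided
  | twoSided

/-- The condition that a Mathieu subspace `M` of type `ϑ` imposes on elements `a`, `b`, `c` of the
algebra; "`m ≫ 0`" is "for all sufficiently large `m`". -/
def MathieuType.Absorbs {R A : Type*} [CommRing R] [Ring A] [Algebra R A] (ϑ : MathieuType)
    (M : Submodule R A) (a b c : A) : Prop :=
  match ϑ with
  | .left => ∀ᶠ m : ℕ in Filter.atTop, b * a ^ m ∈ M
  | .right => ∀ᶠ m : ℕ in Filter.atTop, a ^ m * c ∈ M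
  | .preTwoSided => ∀ᶠ m : ℕ in Filter.atTop, b * a ^ m ∈ M ∧ a ^ m * c ∈ M
  | .twoSided => ∀ᶠ m : ℕ in Filter.atTop, b * a ^ m * c ∈ M

/-- `M` is a `ϑ`-Mathieu subspace of the associative `R`-algebra `A`. -/
def IsMathieuSubspace {R A : Type*} [CommRing R] [Ring A] [Algebra R A] (ϑ : MathieuType)
    (M : Submodule R A) : Prop :=
  ∀ a b c : A, (∀ m : ℕ, 1 ≤ m → a ^ m ∈ M) → ϑ.Absorbs M a b c

/-! Suppose that all positive powers of a non-nilpotent `a` lie in `M`. Then `M` contains a nonzero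
idempotent, namely a polynomial in `a` without constant term. If traces vanish on `M`, the
characteristic divides the rank of this idempotent, so both equal `n` and the idempotent is the
identity. Under the stated conditions every such `a` is therefore nilpotent, and absorption is
trivial for all four types.

Conversely, a Mathieu subspace contains all left multiples, or all right multiples, of its
idempotents; transposition reduces the second case to the first. In particular a proper one does not
contain the identity. Let `V` be the orthogonal of `M` for the trace form, so `dim V < n`. Every
idempotent `e` orthogonal to `V` lies in `M`, which yields `e V = 0`, and the claim becomes `1 ∈ V`.

Perturbing a projection onto `U` shows that some element of `V` stabilizes `U` and acts on it
nontrivially (`exists_stabilizing`). For suitable `U` this gives that the ranges of `V` span the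
space, and that each `u` with `dim V u` maximal is fixed by some `C ∈ V` such that `1 - C` has range
in `K u`. Such `u` span the space because `K` has at least `n` elements. A basis of them gives `n`
operators in `V`; these are linearly dependent, which forces one of them to be `1` (`one_mem`). -/

open Module

/-! ### Trace duality and perturbation of idempotents -/

section LinearAlgebra

variable {K E : Type*} [Field K] [AddCommGroup E] [Module K E]

variable (K E) in
/-- The linear map to the dual space which is given by the trace form of `End K E`. -/
noncomputable def traceDual : End K E →ₗ[K] Dual K (End K E) :=
  (LinearMap.mul K (End K E)).compr₂ (LinearMap.trace K E)

theorem traceDual_apply (X A : End K E) : traceDual K E X A = LinearMap.trace K E (X * A) := rfl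

variable [FiniteDimensional K E]

theorem traceDual_injective : Function.Injective (traceDual K E) := by
  rw [← LinearMap.ker_eq_bot, LinearMap.ker_eq_bot']
  intro X hX
  by_contra hne
  obtain ⟨v, hv⟩ : ∃ v, X v ≠ 0 := by
    by_contra! h
    exact hne (LinearMap.ext h)
  obtain ⟨f, hf⟩ : ∃ f : Dual K E, f (X v) ≠ 0 := by
    by_contra! h
    exact hv ((Module.forall_dual_apply_eq_zero_iff K _).mp h)
  have h1 : traceDual K E X (f.smulRight v) = 0 := by rw [hX]; rfl
  have h2 : X * f.smulRight v = f.smulRight (X v) := by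
    ext x; simp
  have h3 : LinearMap.trace K E (X * f.smulRight v) = 0 := h1
  rw [h2, LinearMap.trace_smulRight] at h3
  exact hf h3

theorem traceDual_surjective : Function.Surjective (traceDual K E) :=
  (LinearMap.injective_iff_surjective_of_finrank_eq_finrank
    Subspace.dual_finrank_eq.symm).mp traceDual_injective

/-- Every linear functional on `End K E` is represented by an endomorphism via the trace. -/
theorem exists_trace_mul_eq (ψ : Dual K (End K E)) :
    ∃ X : End K E, ∀ A, LinearMap.trace K E (X * A) = ψ A := by
  obtain ⟨X, hX⟩ := traceDual_surjective ψ
  exact ⟨X, fun A => by rw [← hX]; rfl⟩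

/-- Every idempotent `e` which is orthogonal to `V` with respect to the trace form satisfies
`e V = 0`. -/
def AnnihilatedByOrthogonalIdempotents (V : Submodule K (End K E)) : Prop :=
  ∀ e : End K E, IsIdempotentElem e → (∀ C ∈ V, LinearMap.trace K E (e * C) = 0) →
    ∀ C ∈ V, e * C = 0

namespace AnnihilatedByOrthogonalIdempotents

variable {V : Submodule K (End K E)}

/-- If every element of `V` that stabilizes `U` kills `u ∈ U` and maps `U` into the line through `u`,
then some endomorphism `e` fixes `U` pointwise and satisfies `e V = 0`. -/
theorem exists_fixing (H : AnnihilatedByOrthogonalIdempotents V) (U : Submodule K E) {u : E}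
    (hu : u ∈ U)
    (hU : ∀ C ∈ V, (∀ x ∈ U, C x ∈ U) → C u = 0 ∧ ∀ x ∈ U, C x ∈ Submodule.span K {u}) :
    ∃ e : End K E, (∀ x ∈ U, e x = x) ∧ ∀ C ∈ V, e * C = 0 := by
  obtain ⟨p, hp⟩ := U.subtype.exists_leftInverse_of_injective U.ker_subtype
  obtain ⟨e, he⟩ : ∃ e : End K E, e = U.subtype ∘ₗ p := ⟨_, rfl⟩
  have heU : ∀ x, e x ∈ U := fun x => by rw [he]; exact (p x).2
  have hfix : ∀ x ∈ U, e x = x := fun x hx => by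
    rw [he]
    exact congrArg Subtype.val (LinearMap.congr_fun hp ⟨x, hx⟩)
  have hee : e * e = e := LinearMap.ext fun x => hfix _ (heU x)
  -- The kernel of `Φ` consists of the `C` that stabilize `U`. For them `C * e` has square zero, so
  -- `τ` vanishes there and factors through `Φ` as `tr (X * Φ C)`. Subtracting `e * X * (1 - e)`
  -- from `e` then cancels the pairing with `V`.
  let Φ : V →ₗ[K] End K E :=
    (LinearMap.mulLeft K (1 - e) ∘ₗ LinearMap.mulRight K e) ∘ₗ V.subtype
  let τ : Dual K V := (LinearMap.trace K E ∘ₗ LinearMap.mulLeft K e) ∘ₗ V.subtype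
  have hτ : τ ∈ LinearMap.range Φ.dualMap := by
    rw [LinearMap.range_dualMap_eq_dualAnnihilator_ker, Submodule.mem_dualAnnihilator]
    intro C hC
    have hC' : (1 - e) * ((C : End K E) * e) = 0 := hC
    have hst : ∀ x ∈ U, (C : End K E) x ∈ U := by
      intro x hx
      have := LinearMap.congr_fun hC' x
      simp only [End.mul_apply, LinearMap.sub_apply, End.one_apply, LinearMap.zero_apply,
        hfix x hx, sub_eq_zero] at this
      rw [this]
      exact heU _
    obtain ⟨h0, h1⟩ := hU C C.2 hst
    have hnil : IsNilpotent ((C : End K E) * e) := by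
      refine ⟨2, LinearMap.ext fun x => ?_⟩
      obtain ⟨a, ha⟩ := Submodule.mem_span_singleton.mp (h1 _ (heU x))
      simp [pow_two, ← ha, hfix u hu, h0]
    change LinearMap.trace K E (e * C) = 0
    rw [LinearMap.trace_mul_comm]
    exact (LinearMap.isNilpotent_trace_of_isNilpotent hnil).eq_zero
  obtain ⟨ψ, hψ⟩ := hτ
  obtain ⟨X, hX⟩ := exists_trace_mul_eq ψ
  have hfix' : ∀ x ∈ U, (e - e * X * (1 - e)) x = x := by
    intro x hx
    simp [hfix x hx]
  refine ⟨e - e * X * (1 - e), hfix', H _ ?_ ?_⟩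
  · refine LinearMap.ext fun x => hfix' _ ?_
    exact U.sub_mem (heU _) (heU _)
  · intro C hC
    have h2 : ψ (Φ ⟨C, hC⟩) = τ ⟨C, hC⟩ := LinearMap.congr_fun hψ ⟨C, hC⟩
    have h3 : LinearMap.trace K E (X * ((1 - e) * (C * e))) = LinearMap.trace K E (e * C) := by
      rw [hX]; exact h2
    rw [sub_mul, map_sub, ← h3, sub_eq_zero]
    rw [show X * ((1 - e) * (C * e)) = (X * (1 - e) * C) * e by simp only [mul_assoc],
      LinearMap.trace_mul_comm]
    simp only [mul_assoc]

/-- Otherwise `exists_fixing` gives an `e` which fixes `u` but kills all ranges of elements of `V`,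
hence kills `u`. -/
theorem exists_stabilizing (H : AnnihilatedByOrthogonalIdempotents V) (U : Submodule K E) {u : E}
    (hu : u ∈ U) (hu0 : u ≠ 0) (huV : u ∈ ⨆ C ∈ V, LinearMap.range C) :
    ∃ C ∈ V, (∀ x ∈ U, C x ∈ U) ∧ (C u = 0 → ∃ x ∈ U, C x ∉ Submodule.span K {u}) := by
  by_contra! h
  obtain ⟨e, he, heV⟩ := H.exists_fixing U hu h
  have : (⨆ C ∈ V, LinearMap.range C) ≤ LinearMap.ker e := by
    refine iSup₂_le fun C hC => ?_
    rintro _ ⟨x, rfl⟩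
    exact LinearMap.congr_fun (heV C hC) x
  exact hu0 ((he u hu).symm.trans (this huV))

end AnnihilatedByOrthogonalIdempotents
end LinearAlgebra

/-! ### The ranges of the elements of `V` span the space -/

section LinearAlgebra

variable {K E : Type*} [Field K] [AddCommGroup E] [Module K E] [FiniteDimensional K E]

namespace AnnihilatedByOrthogonalIdempotents

variable {V : Submodule K (End K E)}

/-- If `e` is an idempotent whose kernel is the sum of the ranges of the elements of `V`, then every
linear map from the range of `e` to its kernel is the restriction of an element of `V`. -/
theorem exists_mul_eq (H : AnnihilatedByOrthogonalIdempotents V) {e : End K E}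
    (he : IsIdempotentElem e) (hker : LinearMap.ker e = ⨆ C ∈ V, LinearMap.range C) (Z : End K E) :
    ∃ C ∈ V, C * e = (1 - e) * Z * e := by
  have heV : ∀ C ∈ V, e * C = 0 := fun C hC => LinearMap.ext fun x => by
    have : C x ∈ LinearMap.ker e := by
      rw [hker]
      exact Submodule.mem_iSup_of_mem C (Submodule.mem_iSup_of_mem hC ⟨x, rfl⟩)
    exact this
  let P : Submodule K (End K E) := V.map (LinearMap.mulRight K e)
  suffices h : (1 - e) * Z * e ∈ P from h
  by_contra hZ
  obtain ⟨ψ, hψZ, hψ⟩ := Submodule.exists_le_ker_of_notMem hZ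
  obtain ⟨X, hX⟩ := exists_trace_mul_eq ψ
  have h1 : ∀ C ∈ V, LinearMap.trace K E (X * (C * e)) = 0 := fun C hC => by
    rw [hX]; exact hψ ⟨C, hC, rfl⟩
  -- If `X` is orthogonal to `V * e`, this perturbed idempotent is orthogonal to `V`. The hypothesis
  -- then gives `e * X * C = 0` on `V`, so `e * X` vanishes on the kernel of `e`.
  have hidem : IsIdempotentElem (e + e * X * (1 - e)) := by
    have h0 : (1 - e) * e = 0 := by rw [sub_mul, one_mul, he.eq, sub_self]
    have h00 : e * (1 - e) = 0 := by rw [mul_sub, mul_one, he.eq, sub_self]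
    unfold IsIdempotentElem
    calc (e + e * X * (1 - e)) * (e + e * X * (1 - e))
        = e * e + e * e * X * (1 - e) + e * X * ((1 - e) * e) + e * X * ((1 - e) * e) * X * (1 - e) := by
          noncomm_ring
      _ = _ := by rw [h0, he.eq]; simp
  have h2 : ∀ C ∈ V, (e + e * X * (1 - e)) * C = e * X * C := fun C hC => by
    calc (e + e * X * (1 - e)) * C = e * C + e * X * C - e * X * (e * C) := by noncomm_ring
      _ = _ := by rw [heV C hC]; simp
  have h3 : ∀ C ∈ V, e * X * C = 0 := fun C hC => by
    rw [← h2 C hC]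
    refine H _ hidem (fun C hC => ?_) C hC
    rw [h2 C hC, mul_assoc, LinearMap.trace_mul_comm, mul_assoc]
    exact h1 C hC
  have h4 : (⨆ C ∈ V, LinearMap.range C) ≤ LinearMap.ker (e * X) := by
    refine iSup₂_le fun C hC => ?_
    rintro _ ⟨x, rfl⟩
    exact LinearMap.congr_fun (h3 C hC) x
  apply hψZ
  rw [← hX, show X * ((1 - e) * Z * e) = (X * (1 - e) * Z) * e by simp only [mul_assoc],
    LinearMap.trace_mul_comm]
  convert map_zero (LinearMap.trace K E)
  ext x
  have : (1 - e) (Z x) ∈ LinearMap.ker e := by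
    have h5 : e (e (Z x)) = e (Z x) := LinearMap.congr_fun he.eq (Z x)
    simp [h5]
  rw [hker] at this
  exact h4 this

/-- The sum of the ranges of the elements of `V` is the whole space. -/
theorem iSup_range_eq_top (H : AnnihilatedByOrthogonalIdempotents V) (hV : finrank K V < finrank K E)
    (hV0 : V ≠ ⊥) : (⨆ C ∈ V, LinearMap.range C) = ⊤ := by
  set W : Submodule K E := ⨆ C ∈ V, LinearMap.range C with hW
  have hmem : ∀ C ∈ V, ∀ x, C x ∈ W := fun C hC x =>
    Submodule.mem_iSup_of_mem C (Submodule.mem_iSup_of_mem hC ⟨x, rfl⟩)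
  by_contra hne
  obtain ⟨U', hU'⟩ := W.exists_isCompl
  obtain ⟨w, hwW, hw0⟩ : ∃ w ∈ W, w ≠ 0 := by
    obtain ⟨C, hC, hC0⟩ := V.exists_mem_ne_zero_of_ne_bot hV0
    obtain ⟨x, hx⟩ : ∃ x, C x ≠ 0 := by
      by_contra! h
      exact hC0 (LinearMap.ext h)
    exact ⟨C x, hmem C hC x, hx⟩
  have hinter : ∀ x ∈ U' ⊔ Submodule.span K {w}, x ∈ W → x ∈ Submodule.span K {w} := by
    intro x hx hxW
    obtain ⟨y, hy, z, hz, rfl⟩ := Submodule.mem_sup.mp hx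
    have hzW : z ∈ W := (Submodule.span_singleton_le_iff_mem w W).mpr hwW hz
    have : y ∈ W ⊓ U' := ⟨by simpa using W.sub_mem hxW hzW, hy⟩
    rw [hU'.inf_eq_bot, Submodule.mem_bot] at this
    simpa [this] using hz
  have hw : w ∈ U' ⊔ Submodule.span K {w} :=
    Submodule.mem_sup_right (Submodule.mem_span_singleton_self w)
  obtain ⟨C, hC, hCU, hCw⟩ := H.exists_stabilizing (U' ⊔ Submodule.span K {w}) hw hw0 hwW
  have hspan : ∀ x ∈ U' ⊔ Submodule.span K {w}, C x ∈ Submodule.span K {w} := fun x hx =>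
    hinter _ (hCU x hx) (hmem C hC x)
  obtain ⟨c, hc⟩ := Submodule.mem_span_singleton.mp (hspan w hw)
  have hc0 : c ≠ 0 := by
    rintro rfl
    obtain ⟨x, hx, hx'⟩ := hCw (by rw [← hc, zero_smul])
    exact hx' (hspan x hx)
  have hCne : C ≠ 0 := by
    rintro rfl
    exact smul_ne_zero hc0 hw0 hc
  obtain ⟨e₀, hker₀, hrange₀, he₀⟩ : ∃ e₀ : End K E, LinearMap.ker e₀ = W ∧
      (∀ x, e₀ x ∈ U') ∧ ∀ x ∈ U', e₀ x = x := by
    refine ⟨U'.subtype ∘ₗ U'.projectionOnto W hU'.symm, ?_, fun x => ?_, fun x hx => ?_⟩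
    · rw [LinearMap.ker_comp_of_ker_eq_bot _ U'.ker_subtype]
      simp
    · exact (U'.projectionOnto W hU'.symm x).2
    · simpa using congrArg Subtype.val (Submodule.projectionOnto_apply_left hU'.symm ⟨x, hx⟩)
  have he₀V : ∀ D ∈ V, ∀ x, e₀ (D x) = 0 := fun D hD x => by
    have := hmem D hD x
    rwa [← hker₀] at this
  -- Since `C` maps `U'` into the line of `w` and `C w = c • w`, this correction gives `C * e = 0`
  -- without changing the kernel `W`.
  let e : End K E := e₀ - c⁻¹ • (C * e₀)
  have hidem₀ : ∀ x, e₀ (e₀ x) = e₀ x := fun x => he₀ _ (hrange₀ x)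
  have hidem : IsIdempotentElem e := LinearMap.ext fun x => by
    simp [e, hidem₀, he₀V C hC]
  have hker : LinearMap.ker e = W := by
    refine le_antisymm (fun x hx => ?_) (fun x hx => ?_)
    · have h1 : e₀ (e x) = 0 := by rw [LinearMap.mem_ker.mp hx, map_zero]
      rw [← hker₀]
      simpa [e, hidem₀, he₀V C hC] using h1
    · rw [← hker₀] at hx
      simp [e, LinearMap.mem_ker.mp hx]
  have hCe : C * e = 0 := LinearMap.ext fun x => by
    obtain ⟨b, hb⟩ := Submodule.mem_span_singleton.mp
      (hspan (e₀ x) (Submodule.mem_sup_left (hrange₀ x)))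
    have : c⁻¹ * b * c = b := by field_simp
    simp [e, ← hb, ← hc, smul_smul, this]
  have hdim : finrank K (LinearMap.range e) + finrank K W = finrank K E := by
    rw [← hker]; exact e.finrank_range_add_finrank_ker
  let T : V →ₗ[K] End K E := LinearMap.mulRight K e ∘ₗ V.subtype
  let S : (LinearMap.range e →ₗ[K] W) →ₗ[K] End K E :=
    { toFun := fun φ => W.subtype ∘ₗ φ ∘ₗ e.rangeRestrict
      map_add' := fun _ _ => rfl
      map_smul' := fun _ _ => rfl }
  have hS : Function.Injective S := by
    intro φ φ' h
    ext ⟨_, x, rfl⟩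
    exact LinearMap.congr_fun h x
  have hST : LinearMap.range S ≤ LinearMap.range T := by
    rintro _ ⟨φ, rfl⟩
    obtain ⟨D, hD, hDe⟩ := H.exists_mul_eq hidem hker (S φ)
    refine ⟨⟨D, hD⟩, hDe.trans (LinearMap.ext fun x => ?_)⟩
    have h1 : e.rangeRestrict (e x) = e.rangeRestrict x :=
      Subtype.ext (LinearMap.congr_fun hidem.eq x)
    have h2 : e (S φ x) = 0 := hker.ge (φ (e.rangeRestrict x)).2
    have h3 : S φ (e x) = S φ x := congrArg (fun y => (φ y : E)) h1
    simp [h3, h2]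
  have hTker : LinearMap.ker T ≠ ⊥ := by
    intro h
    have : (⟨C, hC⟩ : V) ∈ LinearMap.ker T := hCe
    rw [h, Submodule.mem_bot] at this
    exact hCne (congrArg Subtype.val this)
  -- With `a + 1` and `b + 1` the dimensions of the range and kernel of `e`, `V` has dimension at
  -- least `(a + 1) * (b + 1) + 1`, the last summand coming from `C`. This is at least `a + b + 2 =
  -- dim E`, a contradiction.
  have h1 := T.finrank_range_add_finrank_ker
  have h2 : 0 < finrank K (LinearMap.ker T) :=
    Nat.pos_of_ne_zero fun h => hTker (Submodule.finrank_eq_zero.mp h)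
  have h3 := Submodule.finrank_mono hST
  rw [LinearMap.finrank_range_of_inj hS, finrank_linearMap] at h3
  have h4 : finrank K W < finrank K E := Submodule.finrank_lt hne
  have h5 : 0 < finrank K W := by
    have : Nontrivial W := ⟨⟨w, hwW⟩, 0, fun h => hw0 (congrArg Subtype.val h)⟩
    exact finrank_pos
  obtain ⟨a, ha⟩ : ∃ a, finrank K (LinearMap.range e) = a + 1 :=
    ⟨finrank K (LinearMap.range e) - 1, by omega⟩
  obtain ⟨b, hb⟩ : ∃ b, finrank K W = b + 1 := ⟨finrank K W - 1, by omega⟩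
  rw [ha, hb] at h3
  rw [ha, hb] at hdim
  have : (a + 1) * (b + 1) = a * b + a + b + 1 := by ring
  have := Nat.zero_le (a * b)
  omega

/-- Every vector is fixed by an element of `V`. -/
theorem exists_apply_eq (H : AnnihilatedByOrthogonalIdempotents V)
    (htop : (⨆ C ∈ V, LinearMap.range C) = ⊤) (u : E) : ∃ C ∈ V, C u = u := by
  rcases eq_or_ne u 0 with rfl | hu
  · exact ⟨0, V.zero_mem, rfl⟩
  obtain ⟨C, hC, hst, hnz⟩ := H.exists_stabilizing (Submodule.span K {u})
    (Submodule.mem_span_singleton_self u) hu (htop ▸ Submodule.mem_top)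
  obtain ⟨c, hc⟩ := Submodule.mem_span_singleton.mp (hst u (Submodule.mem_span_singleton_self u))
  have hc0 : c ≠ 0 := by
    rintro rfl
    obtain ⟨x, hx, hx'⟩ := hnz (by rw [← hc, zero_smul])
    exact hx' (hst x hx)
  exact ⟨c⁻¹ • C, V.smul_mem _ hC, by rw [LinearMap.smul_apply, ← hc, smul_smul,
    inv_mul_cancel₀ hc0, one_smul]⟩

end AnnihilatedByOrthogonalIdempotents
end LinearAlgebra

/-! ### Determinants of pencils and vectors of maximal rank -/

section LinearAlgebra

variable {K E : Type*} [Field K] [AddCommGroup E] [Module K E]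

theorem exists_dual_family_of_linearIndependent {m : Type*} [Fintype m] [DecidableEq m]
    {v : m → E} (hv : LinearIndependent K v) :
    ∃ f : m → Dual K E, Matrix.of (fun i j => f j (v i)) = 1 := by
  obtain ⟨g, hg⟩ := (Fintype.linearCombination K v).exists_leftInverse_of_injective
    (LinearMap.ker_eq_bot'.mpr fun x hx => funext (Fintype.linearIndependent_iff.mp hv x hx))
  refine ⟨fun j => LinearMap.proj j ∘ₗ g, ?_⟩
  ext i j
  have := congrFun (LinearMap.congr_fun hg (Pi.single i 1)) j
  simp only [LinearMap.comp_apply, Fintype.linearCombination_apply_single, one_smul,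
    LinearMap.id_apply] at this
  simp only [Matrix.of_apply, LinearMap.comp_apply, LinearMap.proj_apply, this]
  rw [Matrix.one_apply, Pi.single_apply]
  simp [eq_comm]

theorem det_dual_apply_eq_zero {m : Type*} [Fintype m] [DecidableEq m]
    {v : m → E} (hv : ¬ LinearIndependent K v) (f : m → Dual K E) :
    (Matrix.of fun i j => f j (v i)).det = 0 := by
  obtain ⟨g, hg, i, hi⟩ := Fintype.not_linearIndependent_iff.mp hv
  refine Matrix.exists_vecMul_eq_zero_iff.mp ⟨g, fun h => hi (congrFun h i), ?_⟩
  ext j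
  have := congrArg (f j) hg
  simpa [Matrix.vecMul, dotProduct] using this

-- As `det A = 0`, the top coefficient vanishes and the degree drops below the matrix size, so that
-- many points suffice. Saving this one point is what makes `n` scalars enough.
open Polynomial in
theorem exists_det_smul_add_ne_zero {m : Type*} [Fintype m] [DecidableEq m] {A B : Matrix m m K}
    (hA : A.det = 0) (hAB : ((X : K[X]) • A.map C + B.map C).det ≠ 0) (S : Finset K)
    (hS : Fintype.card m ≤ S.card) : ∃ t ∈ S, (t • A + B).det ≠ 0 := by
  by_contra! h
  refine hAB (eq_zero_of_natDegree_lt_card_of_eval_eq_zero' _ S (fun t ht => ?_)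
    (lt_of_lt_of_le ?_ hS))
  · rw [← h t ht, ← coe_evalRingHom, RingHom.map_det]
    congr 1
    ext i j
    simp
    exact mul_comm _ _
  · refine lt_of_le_of_ne (natDegree_det_X_add_C_le A B) fun h1 => hAB ?_
    rw [← leadingCoeff_eq_zero, leadingCoeff, h1, coeff_det_X_add_C_card, hA]

theorem not_linearIndependent_of_mem {m : Type*} [Fintype m] {v : m → E} {P : Submodule K E}
    [FiniteDimensional K P] (hv : ∀ i, v i ∈ P) (hP : finrank K P < Fintype.card m) :
    ¬ LinearIndependent K v := fun h => by
  have h1 := finrank_span_eq_card h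
  have h2 : Submodule.span K (Set.range v) ≤ P :=
    Submodule.span_le.mpr (Set.range_subset_iff.mpr hv)
  have := Submodule.finrank_mono h2
  omega

/-- The space of values at `u` of the elements of `V`. -/
abbrev valuesAt (V : Submodule K (End K E)) (u : E) : Submodule K E :=
  V.map (LinearMap.applyₗ u)

theorem mem_valuesAt {V : Submodule K (End K E)} {C : End K E} (hC : C ∈ V) (u : E) :
    C u ∈ valuesAt V u := ⟨C, hC, rfl⟩

variable [FiniteDimensional K E]

theorem exists_linearIndependent_apply (V : Submodule K (End K E)) (u : E) :
    ∃ c : Fin (finrank K (valuesAt V u)) → End K E, (∀ i, c i ∈ V) ∧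
      LinearIndependent K (fun i => c i u) ∧
      Submodule.span K (Set.range fun i => c i u) = valuesAt V u := by
  let b := finBasis K (valuesAt V u)
  choose c hc hcu using fun i => (b i).2
  have hcu' : (fun i => c i u) = fun i => (b i : E) := funext hcu
  refine ⟨c, hc, ?_, ?_⟩
  · rw [hcu']
    exact b.linearIndependent.map' _ (Submodule.ker_subtype _)
  · rw [hcu', show (fun i => (b i : E)) = (valuesAt V u).subtype ∘ b from rfl, Set.range_comp,
      Submodule.span_image, b.span_eq, Submodule.map_top, Submodule.range_subtype]

open Polynomial in
/-- If `R` takes values in the spaces `valuesAt V x` and vanishes at a point `u` where this space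
has maximal dimension, then the range of `R` is contained in `valuesAt V u`. -/
theorem apply_mem_valuesAt {V : Submodule K (End K E)} {u : E}
    (hu : ∀ x, finrank K (valuesAt V x) ≤ finrank K (valuesAt V u))
    (S : Finset K) (hS : finrank K (valuesAt V u) < S.card)
    {R : End K E} (hR : ∀ x, R x ∈ valuesAt V x) (hRu : R u = 0) (w : E) :
    R w ∈ valuesAt V u := by
  obtain ⟨c, hc, hli, hspan⟩ := exists_linearIndependent_apply V u
  by_contra hw
  rw [← hspan] at hw
  obtain ⟨f, hf⟩ := exists_dual_family_of_linearIndependent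
    (linearIndependent_finCons.mpr ⟨hli, hw⟩)
  let M (v : Fin (finrank K (valuesAt V u) + 1) → E) := Matrix.of fun i j => f j (v i)
  have hdep : ∀ (x : E) (v : Fin (finrank K (valuesAt V u) + 1) → E),
      (∀ i, v i ∈ valuesAt V x) → (M v).det = 0 := fun x v hv =>
    det_dual_apply_eq_zero (not_linearIndependent_of_mem hv
      (by rw [Fintype.card_fin]; exact Nat.lt_succ_of_le (hu x))) f
  -- The rows of `t • A + B` come from `R (u + t • w) = t • R w` and the `c i (u + t • w)`, which
  -- are dependent by maximality. Dividing the first row by `t` gives `t • A' + B'`, whose value at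
  -- `t = 0` has determinant `1`.
  let A := M (Fin.cons (R w) fun i => c i w)
  let B := M (Fin.cons 0 fun i => c i u)
  let A' := M (Fin.cons 0 fun i => c i w)
  let B' := M (Fin.cons (R w) fun i => c i u)
  have hA : A.det = 0 := hdep w _ fun i => by
    refine Fin.cases ?_ (fun i => ?_) i
    · exact hR w
    · exact mem_valuesAt (hc i) w
  have hD : ((X : K[X]) • A.map C + B.map C).det = 0 := by
    by_contra hne
    obtain ⟨t, -, ht⟩ := exists_det_smul_add_ne_zero hA hne S (by simpa using hS)
    apply ht
    rw [show t • A + B = M (Fin.cons (R (u + t • w)) fun i => c i (u + t • w)) from ?_]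
    · refine hdep (u + t • w) _ fun i => ?_
      refine Fin.cases ?_ (fun i => ?_) i
      · exact hR _
      · exact mem_valuesAt (hc i) _
    · ext i j
      refine Fin.cases ?_ (fun i => ?_) i
      · simp [A, B, M, hRu]
      · simp [A, B, M, add_comm]
  have hq : (X : K[X]) * ((X : K[X]) • A'.map C + B'.map C).det = 0 := by
    rw [← hD]
    have := Matrix.det_mul_column
      (Fin.cons X (fun _ => 1) : Fin (finrank K (valuesAt V u) + 1) → K[X])
      ((X : K[X]) • A'.map C + B'.map C)
    simp only [Fin.prod_univ_succ, Fin.cons_zero, Fin.cons_succ, Finset.prod_const_one,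
      mul_one] at this
    rw [← this]
    congr 1
    ext1 i j
    refine Fin.cases ?_ (fun i => ?_) i
    · simp [A, B, A', B', M]
    · simp [A, B, A', B', M]
  have hB' := coeff_det_X_add_C_zero A' B'
  rw [(mul_eq_zero.mp hq).resolve_left X_ne_zero, coeff_zero,
    show B' = 1 from hf, Matrix.det_one] at hB'
  exact zero_ne_one hB'

/-- The vectors at which `valuesAt V` has maximal dimension span the whole space. -/
theorem span_maximal_valuesAt (V : Submodule K (End K E)) (S : Finset K)
    (hS : ∀ u, finrank K (valuesAt V u) < S.card) :
    Submodule.span K {u | ∀ x, finrank K (valuesAt V x) ≤ finrank K (valuesAt V u)} = ⊤ := by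
  classical
  obtain ⟨u, hu⟩ : ∃ u, ∀ x, finrank K (valuesAt V x) ≤ finrank K (valuesAt V u) := by
    have hfin : (Set.range fun u => finrank K (valuesAt V u)).Finite :=
      (Set.finite_lt_nat S.card).subset (by rintro _ ⟨u, rfl⟩; exact hS u)
    obtain ⟨_, ⟨u, rfl⟩, hu⟩ := hfin.exists_maximal (Set.range_nonempty _)
    exact ⟨u, fun x => (le_total _ _).elim id fun h => hu ⟨x, rfl⟩ h⟩
  obtain ⟨c, hc, hli, -⟩ := exists_linearIndependent_apply V u
  have hmax : ∀ w, LinearIndependent K (fun i => c i w) →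
      ∀ x, finrank K (valuesAt V x) ≤ finrank K (valuesAt V w) := by
    intro w hw x
    refine (hu x).trans ?_
    by_contra! h
    exact not_linearIndependent_of_mem (fun i => mem_valuesAt (hc i) w) (by simpa using h) hw
  rw [eq_top_iff]
  rintro w -
  by_cases hw : LinearIndependent K fun i => c i w
  · exact Submodule.subset_span (hmax w hw)
  obtain ⟨f, hf⟩ := exists_dual_family_of_linearIndependent hli
  let A : Matrix _ _ K := Matrix.of fun i j => f j (c i w)
  let B : Matrix _ _ K := Matrix.of fun i j => f j (c i u)
  -- A nonzero `t` is needed to recover `w` from `u` and `u + t • w`; removing `0` from `S` costs at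
  -- most one point, which the strict bound on `S.card` allows.
  obtain ⟨t, ht, htd⟩ := exists_det_smul_add_ne_zero (A := A) (B := B)
    (det_dual_apply_eq_zero hw f) (fun h => by
      have h0 := Polynomial.coeff_det_X_add_C_zero A B
      rw [h, Polynomial.coeff_zero, show B = 1 from hf, Matrix.det_one] at h0
      exact zero_ne_one h0) (S.erase 0) (by
      have := Finset.pred_card_le_card_erase (s := S) (a := 0)
      have := hS u
      simp only [Fintype.card_fin]
      omega)
  have ht0 : t ≠ 0 := Finset.ne_of_mem_erase ht
  have hli' : LinearIndependent K fun i => c i (u + t • w) := by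
    by_contra h
    apply htd
    rw [← det_dual_apply_eq_zero h f]
    congr 1
    ext i j
    simp [A, B, add_comm]
  have h1 : u + t • w ∈ Submodule.span K
      {u | ∀ x, finrank K (valuesAt V x) ≤ finrank K (valuesAt V u)} :=
    Submodule.subset_span (hmax _ hli')
  have h2 := Submodule.sub_mem _ h1 (Submodule.subset_span hu)
  rw [add_sub_cancel_left] at h2
  exact (Submodule.smul_mem_iff _ ht0).mp h2

end LinearAlgebra

/-! ### Operators in `V` that differ from the identity by rank at most one -/

section LinearAlgebra

variable {K E : Type*} [Field K] [AddCommGroup E] [Module K E] [FiniteDimensional K E]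

/-- Let `P` be a proper subspace containing the range of `1 - C` for all `C ∈ V` which fix `u`.
If no such `1 - C` has its range in the line through `u`, then some subspace `U'` which
is independent of `P` is not mapped into this line by any such `1 - C`. -/
theorem exists_disjoint_forall_exists_notMem {V : Submodule K (End K E)} {u : E} {P : Submodule K E}
    (hno : ∀ C ∈ V, C u = u → ∃ x, x - C x ∉ Submodule.span K {u}) (k : ℕ)
    (U' : Submodule K E) (hU' : P ⊓ U' = ⊥) (D : Submodule K (End K E))
    (hD : ∀ C, C ∈ D ↔ C ∈ V ∧ C u = 0 ∧ ∀ x ∈ U', C x ∈ Submodule.span K {u})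
    (hk : finrank K D = k) (hdim : k + finrank K U' + finrank K P < finrank K E) :
    ∃ U'' : Submodule K E, P ⊓ U'' = ⊥ ∧
      ∀ C ∈ V, C u = u → ∃ x ∈ U'', x - C x ∉ Submodule.span K {u} := by
  induction k using Nat.strong_induction_on generalizing U' D with
  | _ k ih =>
    by_cases hex : ∀ C ∈ V, C u = u → ∃ x ∈ U', x - C x ∉ Submodule.span K {u}
    · exact ⟨U', hU', hex⟩
    push Not at hex
    obtain ⟨C, hC, hCu, hCU⟩ := hex
    -- Two proper subspaces do not cover `E`.
    obtain ⟨w, hwP, hw⟩ : ∃ w, w ∉ P ⊔ U' ∧ w - C w ∉ Submodule.span K {u} := by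
      obtain ⟨x, hx⟩ := hno C hC hCu
      obtain ⟨y, hy⟩ : ∃ y, y ∉ P ⊔ U' := by
        by_contra! h
        have h1 : P ⊔ U' = ⊤ := eq_top_iff.mpr fun y _ => h y
        have h2 := Submodule.finrank_add_le_finrank_add_finrank P U'
        rw [h1, finrank_top] at h2
        omega
      by_cases hxP : x ∈ P ⊔ U'
      · by_cases hyu : y - C y ∈ Submodule.span K {u}
        · refine ⟨x + y, fun h => hy ?_, fun h => hx ?_⟩
          · simpa using Submodule.sub_mem _ h hxP
          · have := Submodule.sub_mem _ h hyu
            rw [map_add] at this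
            convert this using 1
            abel
        · exact ⟨y, hy, hyu⟩
      · exact ⟨x, hxP, hx⟩
    let D' : Submodule K (End K E) :=
      D ⊓ (Submodule.span K {u}).comap (LinearMap.applyₗ w)
    have hlt : D' < D → finrank K D' < k := fun h => hk ▸ Submodule.finrank_lt_finrank_of_lt h
    have hD' : ∀ A, A ∈ D' ↔
        A ∈ V ∧ A u = 0 ∧ ∀ x ∈ U' ⊔ Submodule.span K {w}, A x ∈ Submodule.span K {u} := by
      intro A
      simp only [D', Submodule.mem_inf, hD, Submodule.mem_comap, LinearMap.applyₗ_apply_apply,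
        and_assoc]
      refine and_congr_right fun _ => and_congr_right fun _ => ⟨fun ⟨h1, h2⟩ x hx => ?_,
        fun h => ⟨fun x hx => h x (Submodule.mem_sup_left hx),
          h w (Submodule.mem_sup_right (Submodule.mem_span_singleton_self w))⟩⟩
      obtain ⟨y, hy, z, hz, rfl⟩ := Submodule.mem_sup.mp hx
      obtain ⟨a, rfl⟩ := Submodule.mem_span_singleton.mp hz
      rw [map_add, map_smul]
      exact Submodule.add_mem _ (h1 y hy) (Submodule.smul_mem _ a h2)
    have hdisj : P ⊓ (U' ⊔ Submodule.span K {w}) = ⊥ := by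
      rw [eq_bot_iff]
      rintro x ⟨hxP, hx⟩
      obtain ⟨y, hy, z, hz, rfl⟩ := Submodule.mem_sup.mp hx
      obtain ⟨a, rfl⟩ := Submodule.mem_span_singleton.mp hz
      have ha : a = 0 := by
        by_contra ha
        apply hwP
        rw [← Submodule.smul_mem_iff _ ha]
        have := Submodule.sub_mem _ (Submodule.mem_sup_left (T := U') hxP)
          (Submodule.mem_sup_right hy)
        simpa using this
      have hyP : y ∈ P ⊓ U' := ⟨by simpa [ha] using hxP, hy⟩
      rw [hU'] at hyP
      simpa [ha] using hyP
    by_cases hex' : ∀ A ∈ V, A u = u →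
        ∃ x ∈ U' ⊔ Submodule.span K {w}, x - A x ∉ Submodule.span K {u}
    · exact ⟨_, hdisj, hex'⟩
    push Not at hex'
    obtain ⟨A, hA, hAu, hAU⟩ := hex'
    -- If `A` still defeats the enlarged subspace, then `C - A` lies in `D` but not in `D'`. So `k`
    -- drops while the dimension of `U'` grows by at most one, and the bound `hdim` persists.
    have hAC : C - A ∈ D := by
      refine (hD _).mpr ⟨V.sub_mem hC hA, by simp [hCu, hAu], fun x hx => ?_⟩
      have := Submodule.sub_mem _ (hAU x (Submodule.mem_sup_left hx)) (hCU x hx)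
      simpa using this
    have hAC' : C - A ∉ D' := fun h => by
      apply hw
      have h1 : (C - A) w ∈ Submodule.span K {u} := h.2
      have h2 := Submodule.sub_mem _
        (hAU w (Submodule.mem_sup_right (Submodule.mem_span_singleton_self w))) h1
      simpa using h2
    have hfin : finrank K D' < k :=
      hlt (lt_of_le_of_ne inf_le_left fun h => hAC' (h ▸ hAC))
    refine ih _ hfin _ hdisj D' hD' rfl ?_
    have h1 : finrank K ↥(U' ⊔ Submodule.span K {w}) ≤ finrank K U' + 1 :=
      (Submodule.finrank_add_le_finrank_add_finrank _ _).trans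
        (Nat.add_le_add_left ((finrank_span_le_card {w}).trans (by simp)) _)
    omega

namespace AnnihilatedByOrthogonalIdempotents

variable {V : Submodule K (End K E)}

/-- Otherwise there is a `U'` independent of `valuesAt V u` on which every candidate fails. An
element of `V` stabilizing `U' ⊔ K u` acts on `u` by a scalar `c`. Maximality at `u` puts the range
of `C` (if `c = 0`) or of `1 - c⁻¹ • C` (if `c ≠ 0`) inside `valuesAt V u`, which meets `U' ⊔ K u`
only in `K u`; both cases are contradictory. -/
theorem exists_apply_eq_sub_mem_span (H : AnnihilatedByOrthogonalIdempotents V)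
    (hV : finrank K V < finrank K E) (S : Finset K) (hS : finrank K E ≤ S.card)
    (htop : (⨆ C ∈ V, LinearMap.range C) = ⊤) {u : E} (hu0 : u ≠ 0)
    (hu : ∀ x, finrank K (valuesAt V x) ≤ finrank K (valuesAt V u)) :
    ∃ C ∈ V, C u = u ∧ ∀ x, x - C x ∈ Submodule.span K {u} := by
  have hr : finrank K (valuesAt V u) ≤ finrank K V := Submodule.finrank_map_le _ _
  have hmem : ∀ x, x ∈ valuesAt V x := fun x => by
    obtain ⟨C, hC, hCx⟩ := H.exists_apply_eq htop x
    exact ⟨C, hC, hCx⟩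
  have hrange : ∀ R : End K E, (∀ x, R x ∈ valuesAt V x) → R u = 0 →
      ∀ w, R w ∈ valuesAt V u := fun R hR hRu w =>
    apply_mem_valuesAt hu S (by omega) hR hRu w
  by_contra! hno
  let D : Submodule K (End K E) := V ⊓ LinearMap.ker (LinearMap.applyₗ u)
  have hD : finrank K D + finrank K (valuesAt V u) = finrank K V := by
    have h1 : _ + _ = finrank K V :=
      ((LinearMap.applyₗ u : End K E →ₗ[K] E).domRestrict V).finrank_range_add_finrank_ker
    have h2 : LinearMap.range ((LinearMap.applyₗ u : End K E →ₗ[K] E).domRestrict V) =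
        valuesAt V u := by
      rw [LinearMap.domRestrict, LinearMap.range_comp, Submodule.range_subtype]
    have h3 : finrank K (LinearMap.ker ((LinearMap.applyₗ u : End K E →ₗ[K] E).domRestrict V)) =
        finrank K D := by
      rw [LinearMap.domRestrict, LinearMap.ker_comp, ← Submodule.finrank_map_subtype_eq,
        Submodule.map_comap_subtype]
    rw [h2, h3] at h1
    omega
  obtain ⟨U', hU', hUno⟩ := exists_disjoint_forall_exists_notMem (P := valuesAt V u) hno _ ⊥
    (inf_bot_eq _) D (fun C => by simp [D]) rfl (by rw [finrank_bot]; omega)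
  have huU : u ∈ U' ⊔ Submodule.span K {u} :=
    Submodule.mem_sup_right (Submodule.mem_span_singleton_self u)
  have hinter : ∀ x ∈ U' ⊔ Submodule.span K {u}, x ∈ valuesAt V u → x ∈ Submodule.span K {u} := by
    intro x hx hxV
    obtain ⟨y, hy, z, hz, rfl⟩ := Submodule.mem_sup.mp hx
    have hzV : z ∈ valuesAt V u := (Submodule.span_singleton_le_iff_mem u _).mpr (hmem u) hz
    have : y ∈ valuesAt V u ⊓ U' := ⟨by simpa using Submodule.sub_mem _ hxV hzV, hy⟩
    rw [hU', Submodule.mem_bot] at this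
    simpa [this] using hz
  obtain ⟨C, hC, hst, hnz⟩ := H.exists_stabilizing (U' ⊔ Submodule.span K {u}) huU hu0
    (htop ▸ Submodule.mem_top)
  obtain ⟨c, hc⟩ := Submodule.mem_span_singleton.mp
    (hinter _ (hst u huU) (mem_valuesAt hC u))
  by_cases hc0 : c = 0
  · have hCu : C u = 0 := by rw [← hc, hc0, zero_smul]
    obtain ⟨x, hx, hx'⟩ := hnz hCu
    exact hx' (hinter _ (hst x hx) (hrange C (mem_valuesAt hC) hCu x))
  · have hCu : (c⁻¹ • C) u = u := by
      rw [LinearMap.smul_apply, ← hc, smul_smul, inv_mul_cancel₀ hc0, one_smul]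
    have hC' : c⁻¹ • C ∈ V := V.smul_mem _ hC
    obtain ⟨x, hx, hx'⟩ := hUno _ hC' hCu
    have hxU : x ∈ U' ⊔ Submodule.span K {u} := Submodule.mem_sup_left hx
    refine hx' (hinter _ (Submodule.sub_mem _ hxU (Submodule.smul_mem _ _ (hst x hxU))) ?_)
    exact hrange (1 - c⁻¹ • C)
      (fun y => Submodule.sub_mem _ (hmem y) (mem_valuesAt hC' y))
      (by rw [LinearMap.sub_apply, hCu, End.one_apply, sub_self]) x

theorem one_mem (H : AnnihilatedByOrthogonalIdempotents V)
    (hV : finrank K V < finrank K E) (hV0 : V ≠ ⊥) (S : Finset K) (hS : finrank K E ≤ S.card) :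
    1 ∈ V := by
  have htop := H.iSup_range_eq_top hV hV0
  let G : Set E := {u | ∀ x, finrank K (valuesAt V x) ≤ finrank K (valuesAt V u)}
  have hG : Submodule.span K G = ⊤ := span_maximal_valuesAt V S fun u =>
    lt_of_le_of_lt (Submodule.finrank_map_le _ _) (hV.trans_le hS)
  let b := Basis.ofSpan hG.ge
  have hb : ∀ i, b i ∈ G := fun i => Basis.ofSpan_subset hG.ge ⟨i, rfl⟩
  have := FiniteDimensional.fintypeBasisIndex b
  choose C hC hCb hCspan using fun i =>
    H.exists_apply_eq_sub_mem_span hV S hS htop (b.ne_zero i) (hb i)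
  have hdep : ¬ LinearIndependent K C :=
    not_linearIndependent_of_mem hC (by rwa [← finrank_eq_card_basis b])
  obtain ⟨g, hg, j, hj⟩ := Fintype.not_linearIndependent_iff.mp hdep
  -- In `∑ g i • (x - C i x)` only the term `i = j` has a `j`-th coordinate. Taking `x = b j` gives
  -- `∑ g i = 0`, and then `C j = 1`.
  have hcoord : ∀ x, g j * b.repr (x - C j x) j = (∑ i, g i) * b.repr x j := by
    intro x
    have h1 : ∑ i, g i • (x - C i x) = (∑ i, g i) • x := by
      have := LinearMap.congr_fun hg x
      simp only [LinearMap.sum_apply, LinearMap.smul_apply, LinearMap.zero_apply] at this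
      simp only [smul_sub, Finset.sum_sub_distrib, this, sub_zero, Finset.sum_smul]
    have h2 := congrArg (fun y => b.repr y j) h1
    simp only [map_sum, map_smul, Finsupp.coe_finsetSum, Finset.sum_apply, Finsupp.smul_apply,
      smul_eq_mul] at h2
    rw [← h2]
    symm
    apply Finset.sum_eq_single j
    · intro i _ hij
      obtain ⟨a, ha⟩ := Submodule.mem_span_singleton.mp (hCspan i x)
      rw [← ha]
      simp [Finsupp.single_eq_of_ne hij.symm]
    · exact fun h => absurd (Finset.mem_univ j) h
  have hsum : ∑ i, g i = 0 := by
    have := hcoord (b j)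
    simpa [hCb j] using this.symm
  have hone : C j = 1 := LinearMap.ext fun x => by
    have h1 := hcoord x
    rw [hsum, zero_mul, mul_eq_zero] at h1
    obtain ⟨a, ha⟩ := Submodule.mem_span_singleton.mp (hCspan j x)
    have h2 := h1.resolve_left hj
    rw [← ha] at h2
    have ha0 : a = 0 := by simpa using h2
    rw [ha0, zero_smul, eq_comm, sub_eq_zero] at ha
    exact ha.symm
  exact hone ▸ hC j

end AnnihilatedByOrthogonalIdempotents
end LinearAlgebra

/-! ### Vanishing trace, and idempotents among polynomials in an element -/

section LinearAlgebra

variable {K E : Type*} [Field K] [AddCommGroup E] [Module K E] [FiniteDimensional K E]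

theorem trace_eq_zero_of_forall_mul_idempotent_mem {M : Submodule K (End K E)} (hM : M ≠ ⊤)
    (hcodim : finrank K (End K E ⧸ M) < finrank K E) (S : Finset K) (hS : finrank K E ≤ S.card)
    (h : ∀ e ∈ M, IsIdempotentElem e → ∀ b, b * e ∈ M) : ∀ A ∈ M, LinearMap.trace K E A = 0 := by
  let T : End K E ≃ₗ[K] Dual K (End K E) :=
    LinearEquiv.ofBijective (traceDual K E) ⟨traceDual_injective, traceDual_surjective⟩
  let V : Submodule K (End K E) := M.dualAnnihilator.map (T.symm : Dual K (End K E) →ₗ[K] End K E)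
  have hV : ∀ C, C ∈ V ↔ ∀ A ∈ M, LinearMap.trace K E (C * A) = 0 := by
    intro C
    simp only [V, Submodule.mem_map_equiv, LinearEquiv.symm_symm, Submodule.mem_dualAnnihilator]
    rfl
  have hVM : finrank K V = finrank K (End K E ⧸ M) := by
    rw [LinearEquiv.finrank_map_eq]
    have h1 := Subspace.finrank_add_finrank_dualAnnihilator_eq M
    have h2 := M.finrank_quotient_add_finrank
    omega
  have hV0 : V ≠ ⊥ := fun h0 => by
    rw [h0, finrank_bot] at hVM
    have h2 := M.finrank_quotient_add_finrank
    exact hM (Submodule.eq_top_of_finrank_eq (by omega))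
  have hmem : ∀ A, (∀ C ∈ V, LinearMap.trace K E (A * C) = 0) → A ∈ M := fun A hA => by
    rw [← Subspace.forall_mem_dualAnnihilator_apply_eq_zero_iff]
    intro φ hφ
    rw [← T.apply_symm_apply φ]
    change LinearMap.trace K E (T.symm φ * A) = 0
    rw [LinearMap.trace_mul_comm]
    exact hA _ (Submodule.mem_map_of_mem hφ)
  -- An idempotent `e` orthogonal to `V` lies in `M`, hence so does each `b * e`; thus `e * C` is
  -- orthogonal to every `b`.
  have H : AnnihilatedByOrthogonalIdempotents V := by
    intro e he heV C hC
    apply traceDual_injective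
    ext b
    rw [map_zero, LinearMap.zero_apply, traceDual_apply, mul_assoc, LinearMap.trace_mul_comm,
      mul_assoc]
    exact (hV C).mp hC _ (h e (hmem e heV) he b)
  intro A hA
  simpa using (hV 1).mp (H.one_mem (hVM ▸ hcodim) hV0 S hS) A hA

theorem exists_finset_card_of_ringChar_notMem (K : Type*) [Field K] {n : ℕ}
    (hchar : ringChar K ∉ Set.Ico 1 n) : ∃ S : Finset K, n ≤ S.card := by
  classical
  refine ⟨(Finset.range n).image (fun k : ℕ => (k : K)), ?_⟩
  rw [Finset.card_image_of_injOn, Finset.card_range]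
  have key : ∀ i j : ℕ, i ≤ j → j < n → (i : K) = j → i = j := by
    intro i j hij hj h
    have h1 : ((j - i : ℕ) : K) = 0 := by rw [Nat.cast_sub hij, h, sub_self]
    have h2 := ringChar.dvd h1
    by_contra hne
    have h3 := Nat.le_of_dvd (by omega) h2
    have h4 : ringChar K ≠ 0 := by
      intro h0
      rw [h0, zero_dvd_iff] at h2
      omega
    exact hchar ⟨by omega, by omega⟩
  intro i hi j hj h
  simp only [Finset.coe_range, Set.mem_Iio] at hi hj
  rcases le_total i j with hij | hij
  · exact key i j hij hj h
  · exact (key j i hij hi h.symm).symm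

open Polynomial in
/-- The powers of a non-nilpotent element of a finite-dimensional algebra span a subspace which
contains a nonzero idempotent. -/
theorem exists_idempotent_mem_of_not_isNilpotent {A : Type*} [Ring A] [Algebra K A]
    [FiniteDimensional K A] {a : A} (ha : ¬ IsNilpotent a) {M : Submodule K A}
    (hM : ∀ m : ℕ, 1 ≤ m → a ^ m ∈ M) : ∃ e ∈ M, IsIdempotentElem e ∧ e ≠ 0 := by
  have hmin : minpoly K a ≠ 0 := minpoly.ne_zero (Algebra.IsIntegral.isIntegral a)
  obtain ⟨q, hq, hXq⟩ := exists_eq_pow_rootMultiplicity_mul_and_not_dvd (minpoly K a) hmin 0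
  rw [map_zero, sub_zero] at hq hXq
  obtain ⟨k, hk⟩ : ∃ k, k = (minpoly K a).rootMultiplicity 0 := ⟨_, rfl⟩
  rw [← hk] at hq
  -- The exponent `k + 1` rather than `k` ensures that the idempotent has no constant term even if
  -- `k = 0`.
  have hcop : IsCoprime (X ^ (k + 1)) q :=
    IsCoprime.pow_left ((irreducible_X.coprime_iff_not_dvd).mpr hXq)
  obtain ⟨α, β, hαβ⟩ := hcop
  have hzero : aeval a (X ^ k * q) = 0 := by rw [← hq, minpoly.aeval]
  refine ⟨aeval a (X * (α * X ^ k)), ?_, ?_, ?_⟩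
  · rw [map_mul, aeval_X, aeval_eq_sum_range, Finset.mul_sum]
    refine M.sum_mem fun i _ => ?_
    rw [mul_smul_comm, ← pow_succ']
    exact M.smul_mem _ (hM _ (by omega))
  · have h1 : (X * (α * X ^ k)) * (X * (α * X ^ k)) =
        X * (α * X ^ k) - (X ^ k * q) * (X * α * β) := by
      linear_combination (X * α * X ^ k) * hαβ
    unfold IsIdempotentElem
    rw [← map_mul, h1, map_sub, map_mul _ (X ^ k * q), hzero, zero_mul, sub_zero]
  · intro h0
    have h1 : aeval a (β * q) = 1 := by
      have := congrArg (aeval a) hαβ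
      rw [map_add, show α * X ^ (k + 1) = X * (α * X ^ k) by ring, h0, zero_add, map_one] at this
      exact this
    refine ha ⟨k, ?_⟩
    calc a ^ k = aeval a (X ^ k * (β * q)) := by rw [map_mul, h1, mul_one, map_pow, aeval_X]
      _ = aeval a ((X ^ k * q) * β) := by congr 1; ring
      _ = 0 := by rw [map_mul, hzero, zero_mul]

/-- If the trace of an idempotent endomorphism vanishes, then its rank is divisible by the
characteristic. -/
theorem ringChar_dvd_finrank_range {e : End K E} (he : IsIdempotentElem e)
    (htr : LinearMap.trace K E e = 0) : ringChar K ∣ finrank K (LinearMap.range e) := by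
  rw [(LinearMap.IsIdempotentElem.isProj_range e he).trace] at htr
  exact ringChar.dvd htr

end LinearAlgebra

/-! ### Transfer to matrices -/

section Matrix

variable {K : Type*} [Field K] {n : ℕ}

open Matrix

theorem trace_eq_zero_of_forall_mul_idempotent_mem_matrix
    (hchar : ringChar K ∉ Set.Ico 1 n) {M : Submodule K (Matrix (Fin n) (Fin n) K)} (hM : M ≠ ⊤)
    (hcodim : finrank K (Matrix (Fin n) (Fin n) K ⧸ M) < n)
    (h : ∀ e ∈ M, IsIdempotentElem e → ∀ b, b * e ∈ M) : ∀ A ∈ M, A.trace = 0 := by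
  let T : Matrix (Fin n) (Fin n) K ≃ₐ[K] End K (Fin n → K) := Matrix.toLinAlgEquiv'
  let M' : Submodule K (End K (Fin n → K)) := M.map (T.toLinearEquiv : Matrix (Fin n) (Fin n) K →ₗ[K] End K (Fin n → K))
  have hmem : ∀ A, A ∈ M' ↔ T.symm A ∈ M := fun A => Submodule.mem_map_equiv _
  obtain ⟨S, hS⟩ := exists_finset_card_of_ringChar_notMem K hchar
  have key := trace_eq_zero_of_forall_mul_idempotent_mem (M := M')
    (fun h => hM (by
      rw [eq_top_iff]
      intro A _
      have : T A ∈ M' := h ▸ Submodule.mem_top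
      simpa [hmem] using this))
    (by
      rw [← (Submodule.Quotient.equiv M M' T.toLinearEquiv rfl).finrank_eq]
      simpa using hcodim)
    S (by simpa using hS)
    (fun e he hidem b => by
      rw [hmem] at he ⊢
      rw [map_mul]
      exact h _ he (hidem.map T.symm) _)
  intro A hA
  have h1 := key (T A) (by rw [hmem]; simpa using hA)
  rwa [show T A = Matrix.toLin' A from rfl, Matrix.trace_toLin'_eq] at h1

/-- A matrix whose positive powers all lie in a space of trace zero matrices is nilpotent, except
possibly if the characteristic is the size of the matrices and the space contains the identity. -/
theorem isNilpotent_of_forall_pow_mem (hchar : ringChar K ∉ Set.Ico 1 n)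
    {M : Submodule K (Matrix (Fin n) (Fin n) K)} (htr : ∀ A ∈ M, A.trace = 0)
    (hone : ringChar K ≠ n ∨ (1 : Matrix (Fin n) (Fin n) K) ∉ M)
    {a : Matrix (Fin n) (Fin n) K} (ha : ∀ m : ℕ, 1 ≤ m → a ^ m ∈ M) : IsNilpotent a := by
  by_contra hnil
  obtain ⟨e, heM, he, he0⟩ := exists_idempotent_mem_of_not_isNilpotent hnil ha
  let T : Matrix (Fin n) (Fin n) K ≃ₐ[K] End K (Fin n → K) := Matrix.toLinAlgEquiv'
  have hdvd := ringChar_dvd_finrank_range (he.map T) (by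
    rw [show T e = Matrix.toLin' e from rfl, Matrix.trace_toLin'_eq, htr e heM])
  have hle : finrank K (LinearMap.range (T e)) ≤ n := by
    simpa using Submodule.finrank_le (LinearMap.range (T e))
  have hpos : finrank K (LinearMap.range (T e)) ≠ 0 := fun h0 => by
    rw [Submodule.finrank_eq_zero, LinearMap.range_eq_bot] at h0
    exact he0 ((map_eq_zero_iff T T.injective).mp h0)
  have h1 := Nat.le_of_dvd (Nat.pos_of_ne_zero hpos) hdvd
  have h2 : ringChar K ≠ 0 := fun h0 => hpos (Nat.eq_zero_of_zero_dvd (h0 ▸ hdvd))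
  -- The characteristic is positive and divides a rank between `1` and `n`; the hypothesis on it
  -- leaves only characteristic and rank both equal to `n`.
  have h3 : n ≤ ringChar K := by
    by_contra h
    exact hchar ⟨by omega, by omega⟩
  have hrank : finrank K (LinearMap.range (T e)) = n := by omega
  have htop : LinearMap.range (T e) = ⊤ := Submodule.eq_top_of_finrank_eq (by simpa using hrank)
  have hTe : T e = 1 := LinearMap.ext fun x => by
    obtain ⟨y, rfl⟩ := LinearMap.range_eq_top.mp htop x
    exact LinearMap.congr_fun (he.map T).eq y
  have he1 : e = 1 := T.injective (by rw [hTe, map_one])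
  rcases hone with h | h
  · omega
  · exact h (he1 ▸ heM)

end Matrix

/-! ### Mathieu subspaces and their idempotents -/

section Mathieu

variable {R A : Type*} [CommRing R] [Ring A] [Algebra R A] {M : Submodule R A}

theorem isMathieuSubspace_of_isNilpotent
    (h : ∀ a : A, (∀ m : ℕ, 1 ≤ m → a ^ m ∈ M) → IsNilpotent a) (ϑ : MathieuType) :
    IsMathieuSubspace ϑ M := by
  intro a b c ha
  obtain ⟨k, hk⟩ := h a ha
  have hev : ∀ᶠ m : ℕ in Filter.atTop, a ^ m = 0 :=
    (Filter.eventually_ge_atTop k).mono fun m hm => pow_eq_zero_of_le hm hk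
  cases ϑ <;> exact hev.mono fun m hm => by simp [hm]

theorem IsIdempotentElem.eventually_pow {e : A} (he : IsIdempotentElem e) {p : A → Prop}
    (h : ∀ᶠ m : ℕ in Filter.atTop, p (e ^ m)) : p e := by
  obtain ⟨m, hm, hm1⟩ := (h.and (Filter.eventually_ge_atTop 1)).exists
  rwa [he.pow_eq (by omega)] at hm

/-- All positive powers of an idempotent coincide, so absorption for large `m` is absorption of `e`
itself. Setting `c = 1` reduces both two-sided types to the left one. -/
theorem IsMathieuSubspace.mul_idempotent_mem_or {ϑ : MathieuType} (h : IsMathieuSubspace ϑ M) :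
    (∀ e ∈ M, IsIdempotentElem e → ∀ b, b * e ∈ M) ∨
      (∀ e ∈ M, IsIdempotentElem e → ∀ c, e * c ∈ M) := by
  have hpow : ∀ e ∈ M, IsIdempotentElem e → ∀ m : ℕ, 1 ≤ m → e ^ m ∈ M := fun e heM he m hm => by
    rwa [he.pow_eq (by omega)]
  cases ϑ with
  | left => exact .inl fun e heM he b =>
      he.eventually_pow (p := fun x => b * x ∈ M) (h e b 1 (hpow e heM he))
  | right => exact .inr fun e heM he c =>
      he.eventually_pow (p := fun x => x * c ∈ M) (h e 1 c (hpow e heM he))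
  | preTwoSided => exact .inl fun e heM he b =>
      (he.eventually_pow (p := fun x => b * x ∈ M ∧ x * 1 ∈ M) (h e b 1 (hpow e heM he))).1
  | twoSided => exact .inl fun e heM he b => mul_one (b * e) ▸
      he.eventually_pow (p := fun x => b * x * 1 ∈ M) (h e b 1 (hpow e heM he))

end Mathieu

theorem mainTheorem2 {K : Type*} [Field K] (n : ℕ) (hchar : ringChar K ∉ Set.Ico 1 n)
    (M : Submodule K (Matrix (Fin n) (Fin n) K)) (hproper : M ≠ ⊤)
    (hcodim : Module.finrank K (Matrix (Fin n) (Fin n) K ⧸ M) < n) (ϑ : MathieuType) :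
    IsMathieuSubspace ϑ M ↔
      (∀ A ∈ M, A.trace = 0) ∧ (ringChar K ≠ n ∨ (1 : Matrix (Fin n) (Fin n) K) ∉ M) := by
  refine ⟨fun h => ?_, fun ⟨htr, hone⟩ => isMathieuSubspace_of_isNilpotent
    (fun a ha => isNilpotent_of_forall_pow_mem hchar htr hone ha) ϑ⟩
  rcases h.mul_idempotent_mem_or with h | h
  · refine ⟨trace_eq_zero_of_forall_mul_idempotent_mem_matrix hchar hproper hcodim h,
      .inr fun h1 => hproper (eq_top_iff.mpr fun A _ => ?_)⟩
    simpa using h 1 h1 .one A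
  · refine ⟨fun A hA => ?_, .inr fun h1 => hproper (eq_top_iff.mpr fun A _ => ?_)⟩
    -- Transposition preserves traces, codimension and idempotents, and turns right multiples into
    -- left multiples.
    · let τ := Matrix.transposeLinearEquiv (Fin n) (Fin n) K K
      have hmem : ∀ B, B ∈ M.map τ.toLinearMap ↔ B.transpose ∈ M := fun B =>
        Submodule.mem_map_equiv _
      rw [← Matrix.trace_transpose]
      refine trace_eq_zero_of_forall_mul_idempotent_mem_matrix (M := M.map τ.toLinearMap) hchar
        (fun h0 => hproper (eq_top_iff.mpr fun B _ => ?_)) ?_ (fun e he hidem b => ?_) _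
        ((hmem _).mpr (by rwa [Matrix.transpose_transpose]))
      · have h2 : B.transpose ∈ M.map τ.toLinearMap := h0 ▸ Submodule.mem_top
        rwa [hmem, Matrix.transpose_transpose] at h2
      · rwa [← (Submodule.Quotient.equiv M _ τ rfl).finrank_eq]
      · rw [hmem] at he ⊢
        rw [Matrix.transpose_mul]
        refine h _ he ?_ _
        unfold IsIdempotentElem
        rw [← Matrix.transpose_mul, hidem.eq]
    · simpa using h 1 h1 .one A
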